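/- Consider the cell-probe model with one-bit cells: memory consists of cells, initially $0$, each holding one bit and addressed by natural numbers; algorithms are deterministic, the running time is the number of cells read or written, and all other computation is free. In the **Multiphase Problem** for the inner product over $\mathbb{F}_2$ with parameters $n,m$, a data structure with update time $t_u$ and query time $t_q$ works in three phases, passing information between algorithm calls only through the memory: 1. it receives $M\in\mathbb{F}_2^{m\times n}$, with rows $M_1,\dots,M_m$, and preprocesses it in time at most $mn\cdot t_u$; 2. it receives the bits of $X\in\mathbb{F}_2^n$ one after another as $n$ updates $(1,X_1),\dots,(n,X_n)$, and processes them in total time at most $n\cdot t_u$; 3. given any $i\in\{1,\dots,m\}$, it outputs $\langle M_i,X\rangle=\sum_{j=1}^n M_{i,j}X_j \bmod 2$ in time at most $t_q$. All bounds, and correctness, are required for all $M$, $X$ and $i$. **Corollary 1.2.** For all constants $C,\delta>0$ there is a constant $c>0$ such that the following holds for all $n$ and all $m\ge 2^{\delta\sqrt n}$. If a data structure solves the Multiphase Problem with update time $t_u$ and query time $t_q$, and its total update time satisfies $n\cdot t_u\le C\,m^{0.99}$, then $t_q\ge c\,n^{1/2}$. -/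

import Mathlib

/-- A memory of one-bit cells, addressed by natural numbers. -/
abbrev Memory : Type := ℕ → ZMod 2

/-- A deterministic algorithm in the cell-probe model with one-bit cells. At each step it either
stops with a result, or reads a cell, or writes a cell. The next step may depend in an arbitrary
way on everything read so far: only memory accesses are counted, computation is free. -/
inductive CellProbe (α : Type) : Type where
  | done (a : α) : CellProbe α
  | read (addr : ℕ) (next : ZMod 2 → CellProbe α) : CellProbe α
  | write (addr : ℕ) (b : ZMod 2) (next : CellProbe α) : CellProbe α

namespace CellProbe

/-- The result of running the algorithm on a memory. -/
def output {α : Type} : CellProbe α → Memory → α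
  | done a, _ => a
  | read addr next, mem => (next (mem addr)).output mem
  | write addr b next, mem => next.output (Function.update mem addr b)

/-- The contents of the memory after the algorithm has been run on it. -/
def finalMemory {α : Type} : CellProbe α → Memory → Memory
  | done _, mem => mem
  | read addr next, mem => (next (mem addr)).finalMemory mem
  | write addr b next, mem => next.finalMemory (Function.update mem addr b)

/-- The running time on a memory: the number of reads and writes performed. -/
def time {α : Type} : CellProbe α → Memory → ℕ
  | done _, _ => 0
  | read addr next, mem => (next (mem addr)).time mem + 1
  | write addr b next, mem => next.time (Function.update mem addr b) + 1

end CellProbe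

/-- A dynamic cell-probe data structure for the Multiphase Problem on `m × n` matrices over `𝔽₂`.
The only thing passed on from one algorithm to the next one is the contents of the memory. -/
structure MultiphaseDS (n m : ℕ) where
  /-- the preprocessing algorithm, given the matrix `M` -/
  preprocess : Matrix (Fin m) (Fin n) (ZMod 2) → CellProbe Unit
  /-- the update algorithm, given a position `j` and the bit `X j` -/
  update : Fin n → ZMod 2 → CellProbe Unit
  /-- the query algorithm, given the index of a row -/
  query : Fin m → CellProbe (ZMod 2)

namespace MultiphaseDS

variable {n m : ℕ}

/-- The memory after preprocessing `M`, starting from the memory that is zero everywhere. -/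
def memoryAfterPreprocess (D : MultiphaseDS n m) (M : Matrix (Fin m) (Fin n) (ZMod 2)) : Memory :=
  (D.preprocess M).finalMemory (fun _ => 0)

/-- Preprocess `M`, then perform the updates `(j, X j)` for `j = 0, …, n - 1` in this order: the
resulting memory, and the total time spent on the updates. -/
def runUpdates (D : MultiphaseDS n m) (M : Matrix (Fin m) (Fin n) (ZMod 2))
    (X : Fin n → ZMod 2) : Memory × ℕ :=
  (List.finRange n).foldl
    (fun s j => ((D.update j (X j)).finalMemory s.1, s.2 + (D.update j (X j)).time s.1))
    (D.memoryAfterPreprocess M, 0)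

/-- `D` solves the Multiphase Problem for the inner product modulo 2 with update time `tu` and
query time `tq` (in the worst case over `M`, `X` and `i`): preprocessing takes time at most
`|M| * tu = m * n * tu`, the `n` updates together take time at most `n * tu`, and then each
query `i` is answered by `⟨M i, X⟩` in time at most `tq`. -/
structure Solves (D : MultiphaseDS n m) (tu tq : ℝ) : Prop where
  preprocess_time : ∀ M : Matrix (Fin m) (Fin n) (ZMod 2),
    ((D.preprocess M).time (fun _ => 0) : ℝ) ≤ (m : ℝ) * (n : ℝ) * tu
  update_time : ∀ (M : Matrix (Fin m) (Fin n) (ZMod 2)) (X : Fin n → ZMod 2),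
    ((D.runUpdates M X).2 : ℝ) ≤ (n : ℝ) * tu
  query_time : ∀ (M : Matrix (Fin m) (Fin n) (ZMod 2)) (X : Fin n → ZMod 2) (i : Fin m),
    ((D.query i).time (D.runUpdates M X).1 : ℝ) ≤ tq
  query_correct : ∀ (M : Matrix (Fin m) (Fin n) (ZMod 2)) (X : Fin n → ZMod 2) (i : Fin m),
    (D.query i).output (D.runUpdates M X).1 = ∑ j, M i j * X j

end MultiphaseDS

/-! A query of at most t steps is a decision tree that can read fewer than 2^t cells, so few cells
are hot, i.e. readable by many queries. Fix a set J of 2^(t+4) vectors. If each update phase changes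
at most T cells and m ≥ 2^(3t+10) T, then for at least half of the queries the updates by J change
no readable cell except hot ones (`exists_unaffected_queries`). The hot contents for all x in J are
fewer than m bits of advice, shared by all queries; the rest of the memory seen by such a query does
not depend on x.

With the advice fixed, `card_answerable_mul_card_le` leaves at most 1/16 of all vectors for each
such row: a short tree would otherwise give a monochromatic rectangle too large for Lindsey's lemma.
Counting over the advice and the set of good rows then covers less than all matrices, a
contradiction (`lt_mul_of_solves_within`). Hence m < 2^(3t+10) T, and T ≤ C m^0.99 forces t to be of
order at least log m ≥ δ√n once n is large. -/

namespace CellProbe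

/-! ### Locality of short runs -/

variable {α : Type}

/-- The addresses that the first `k` steps of an algorithm may read, over all memories. -/
def readAddrs : CellProbe α → ℕ → Finset ℕ
  | done _ => fun _ => ∅
  | read addr next => fun k =>
      match k with
      | 0 => ∅
      | k + 1 => insert addr ((next 0).readAddrs k ∪ (next 1).readAddrs k)
  | write _ _ next => fun k =>
      match k with
      | 0 => ∅
      | k + 1 => next.readAddrs k

theorem zmod_two_cases (b : ZMod 2) : b = 0 ∨ b = 1 := by
  revert b; decide

/-- Strictness carries the induction: 1 + 2(2^k - 1) < 2^(k+1) absorbs the root of the tree. -/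
theorem card_readAddrs_lt (q : CellProbe α) (k : ℕ) : (q.readAddrs k).card < 2 ^ k := by
  induction q generalizing k with
  | done a => simp [readAddrs]
  | read addr next ih =>
    cases k with
    | zero => simp [readAddrs]
    | succ k =>
      have h0 := ih 0 k
      have h1 := ih 1 k
      have h2 := Finset.card_insert_le addr ((next 0).readAddrs k ∪ (next 1).readAddrs k)
      have h3 := Finset.card_union_le ((next 0).readAddrs k) ((next 1).readAddrs k)
      simp only [readAddrs, pow_succ]
      omega
  | write addr b next ih =>
    cases k with
    | zero => simp [readAddrs]
    | succ k =>
      have h0 := ih k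
      simp only [readAddrs, pow_succ]
      omega

/-- A run of length at most `k` depends on the memory only through `readAddrs k`. -/
theorem output_time_congr (q : CellProbe α) (k : ℕ) (mem mem' : Memory)
    (ht : q.time mem ≤ k) (h : ∀ a ∈ q.readAddrs k, mem a = mem' a) :
    q.output mem = q.output mem' ∧ q.time mem = q.time mem' := by
  induction q generalizing k mem mem' with
  | done a => simp [output, time]
  | read addr next ih =>
    cases k with
    | zero => simp [time] at ht
    | succ k =>
      simp only [readAddrs, Finset.mem_insert, Finset.mem_union] at h
      simp only [time, output] at ht ⊢
      have h0 := h addr (Or.inl rfl)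
      rw [← h0]
      have := ih (mem addr) k mem mem' (by omega) (fun a ha => h a (by
        rcases zmod_two_cases (mem addr) with hb | hb <;> rw [hb] at ha <;> simp [ha]))
      exact ⟨this.1, by rw [this.2]⟩
  | write addr b next ih =>
    cases k with
    | zero => simp [time] at ht
    | succ k =>
      simp only [readAddrs] at h
      simp only [time, output] at ht ⊢
      have := ih k (Function.update mem addr b) (Function.update mem' addr b) (by omega)
        (fun a ha => by
          by_cases hab : a = addr
          · simp [hab]
          · simp [hab, h a ha])
      exact ⟨this.1, by rw [this.2]⟩

theorem exists_changed (q : CellProbe α) (mem : Memory) :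
    ∃ S : Finset ℕ, S.card ≤ q.time mem ∧ ∀ a ∉ S, q.finalMemory mem a = mem a := by
  induction q generalizing mem with
  | done a => exact ⟨∅, by simp, by simp [finalMemory]⟩
  | read addr next ih =>
    obtain ⟨S, hS, h⟩ := ih (mem addr) mem
    exact ⟨S, by simp only [time]; omega, h⟩
  | write addr b next ih =>
    obtain ⟨S, hS, h⟩ := ih (Function.update mem addr b)
    refine ⟨insert addr S, (Finset.card_insert_le _ _).trans (by simp only [time]; omega), ?_⟩
    intro a ha
    simp only [Finset.mem_insert, not_or] at ha
    simp only [finalMemory]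
    rw [h a ha.2, Function.update_of_ne ha.1]

end CellProbe

/-! ### Lindsey's lemma -/

/-- The sign `(-1) ^ b`. -/
def bitSign (b : ZMod 2) : ℤ := if b = 0 then 1 else -1

theorem bitSign_add (a b : ZMod 2) : bitSign (a + b) = bitSign a * bitSign b := by
  revert a b; decide

/-- Flipping a coordinate of `a` where `x` is 1 permutes the terms and negates each one. -/
theorem sum_bitSign_dotProduct {n : ℕ} (x : Fin n → ZMod 2) (hx : x ≠ 0) :
    ∑ a : Fin n → ZMod 2, bitSign (∑ j, a j * x j) = 0 := by
  obtain ⟨j, hj⟩ := Function.ne_iff.mp hx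
  have hj1 : x j = 1 := (CellProbe.zmod_two_cases (x j)).resolve_left hj
  have h := Equiv.sum_comp (Equiv.addRight (Pi.single j (1 : ZMod 2)))
    (fun a : Fin n → ZMod 2 => bitSign (∑ j, a j * x j))
  have h2 : ∀ a : Fin n → ZMod 2,
      bitSign (∑ k, (Equiv.addRight (Pi.single j (1 : ZMod 2)) a) k * x k)
        = - bitSign (∑ k, a k * x k) := by
    intro a
    have : ∑ k, (Equiv.addRight (Pi.single j (1 : ZMod 2)) a) k * x k
        = (∑ k, a k * x k) + 1 := by
      simp [add_mul, Finset.sum_add_distrib, Pi.single_apply, hj1]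
    rw [this, bitSign_add]
    simp [bitSign]
  simp only [h2, Finset.sum_neg_distrib] at h
  linarith

/-- Lindsey's lemma for rectangles on which the inner product is constant. -/
theorem card_mul_card_le_of_dotProduct_const {n : ℕ} (B J : Finset (Fin n → ZMod 2))
    (b : ZMod 2) (h : ∀ a ∈ B, ∀ x ∈ J, ∑ j, a j * x j = b) : B.card * J.card ≤ 2 ^ n := by
  -- Second moment: in the expanded square, the pair (x, y) contributes the character sum of x + y,
  -- which vanishes off the diagonal.
  have key : ∑ a : Fin n → ZMod 2, (∑ x ∈ J, bitSign (∑ j, a j * x j)) ^ 2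
      = (2 : ℤ) ^ n * J.card := by
    simp only [sq, Finset.sum_mul_sum, ← bitSign_add, ← Finset.sum_add_distrib, ← mul_add]
    rw [Finset.sum_comm]
    rw [Finset.sum_congr rfl (g := fun _ => (2 : ℤ) ^ n)]
    · simp [mul_comm]
    intro x hx
    rw [Finset.sum_comm, Finset.sum_eq_single_of_mem x hx]
    · have hxx : ∀ i, x i + x i = 0 := fun i => CharTwo.add_self_eq_zero _
      simp [hxx, bitSign]
    · intro y _ hyx
      refine sum_bitSign_dotProduct (fun i => x i + y i) ?_
      intro h0
      exact hyx (funext fun i => ((CharTwo.add_eq_zero).mp (congrFun h0 i)).symm)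
  have hle : ∑ a ∈ B, (∑ x ∈ J, bitSign (∑ j, a j * x j)) ^ 2 ≤ (2 : ℤ) ^ n * J.card := by
    rw [← key]
    exact Finset.sum_le_sum_of_subset_of_nonneg (Finset.subset_univ _) (fun _ _ _ => sq_nonneg _)
  have hB : ∑ a ∈ B, (∑ x ∈ J, bitSign (∑ j, a j * x j)) ^ 2
      = (B.card : ℤ) * (J.card : ℤ) ^ 2 := by
    have hs : bitSign b ^ 2 = 1 := by
      rw [sq, ← bitSign_add, CharTwo.add_self_eq_zero]
      rfl
    rw [Finset.sum_congr rfl (g := fun _ => (J.card : ℤ) ^ 2)]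
    · simp
    intro a ha
    rw [Finset.sum_congr rfl (g := fun _ => bitSign b) (fun x hx => by rw [h a ha x hx])]
    simp [mul_pow, hs]
  rw [hB] at hle
  rcases Nat.eq_zero_or_pos J.card with h0 | h0
  · simp [h0]
  · have h1 : (B.card * J.card) * J.card ≤ 2 ^ n * J.card := by
      zify; linarith
    exact Nat.le_of_mul_le_mul_right h1 h0

/-! ### Decision trees on partly fixed memory -/

open Classical in
/-- The vectors `a` whose inner products with all `x ∈ J` are found by `q` within time `t`, where
the contents of the cells in `H` may depend on `x`, and those of the other cells may not. -/
noncomputable def answerable {n : ℕ} (q : CellProbe (ZMod 2)) (t : ℕ) (H : Finset ℕ)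
    (u : (Fin n → ZMod 2) → Memory) (J : Finset (Fin n → ZMod 2)) : Finset (Fin n → ZMod 2) :=
  Finset.univ.filter fun a => ∃ c : Memory, ∀ x ∈ J,
    q.time (H.piecewise (u x) c) ≤ t ∧ q.output (H.piecewise (u x) c) = ∑ j, a j * x j

theorem mem_answerable {n : ℕ} {q : CellProbe (ZMod 2)} {t : ℕ} {H : Finset ℕ}
    {u : (Fin n → ZMod 2) → Memory} {J : Finset (Fin n → ZMod 2)} {a : Fin n → ZMod 2} :
    a ∈ answerable q t H u J ↔ ∃ c : Memory, ∀ x ∈ J,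
      q.time (H.piecewise (u x) c) ≤ t ∧
        q.output (H.piecewise (u x) c) = ∑ j, a j * x j := by
  simp [answerable]

/-- Each step of the tree costs at most a factor 2: a read in `H` splits `J`, a read outside `H`
splits the vectors `a` by the bit of their memory `c`. At a leaf the inner product is constant on a
rectangle. -/
theorem card_answerable_mul_card_le {n : ℕ} (q : CellProbe (ZMod 2)) (t : ℕ) (H : Finset ℕ)
    (u : (Fin n → ZMod 2) → Memory) (J : Finset (Fin n → ZMod 2)) :
    (answerable q t H u J).card * J.card ≤ 2 ^ n * 2 ^ t := by
  induction q generalizing t u J with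
  | done b =>
    refine (card_mul_card_le_of_dotProduct_const _ J b ?_).trans
      (Nat.le_mul_of_pos_right _ (by positivity))
    intro a ha x hx
    obtain ⟨c, hc⟩ := mem_answerable.mp ha
    exact (hc x hx).2.symm
  | read addr next ih =>
    rcases J.eq_empty_or_nonempty with rfl | ⟨x₀, hx₀⟩
    · simp
    cases t with
    | zero =>
      have : answerable (CellProbe.read addr next) 0 H u J = ∅ := by
        refine Finset.eq_empty_of_forall_notMem fun a ha => ?_
        obtain ⟨c, hc⟩ := mem_answerable.mp ha
        have := (hc x₀ hx₀).1
        simp [CellProbe.time] at this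
      simp [this]
    | succ t =>
      rw [pow_succ]
      by_cases hH : addr ∈ H
      · have hsub : ∀ b : ZMod 2, answerable (CellProbe.read addr next) (t + 1) H u J
            ⊆ answerable (next b) t H u (J.filter fun x => u x addr = b) := by
          intro b a ha
          obtain ⟨c, hc⟩ := mem_answerable.mp ha
          refine mem_answerable.mpr ⟨c, fun x hx => ?_⟩
          obtain ⟨hxJ, hxb⟩ := Finset.mem_filter.mp hx
          have := hc x hxJ
          simp only [CellProbe.time, CellProbe.output, Finset.piecewise_eq_of_mem _ _ _ hH, hxb]
            at this
          exact ⟨by omega, this.2⟩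
        have hJ : J.card ≤ (J.filter fun x => u x addr = 0).card
            + (J.filter fun x => u x addr = 1).card := by
          refine (Finset.card_le_card ?_).trans (Finset.card_union_le _ _)
          intro x hx
          rcases CellProbe.zmod_two_cases (u x addr) with h | h <;> simp [hx, h]
        have h0 := (Nat.mul_le_mul_right _ (Finset.card_le_card (hsub 0))).trans
          (ih 0 t u (J.filter fun x => u x addr = 0))
        have h1 := (Nat.mul_le_mul_right _ (Finset.card_le_card (hsub 1))).trans
          (ih 1 t u (J.filter fun x => u x addr = 1))
        have := Nat.mul_le_mul_left
          (answerable (CellProbe.read addr next) (t + 1) H u J).card hJ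
        linarith
      · have hsub : answerable (CellProbe.read addr next) (t + 1) H u J
            ⊆ answerable (next 0) t H u J ∪ answerable (next 1) t H u J := by
          intro a ha
          obtain ⟨c, hc⟩ := mem_answerable.mp ha
          have hmem : a ∈ answerable (next (c addr)) t H u J := by
            refine mem_answerable.mpr ⟨c, fun x hx => ?_⟩
            have := hc x hx
            simp only [CellProbe.time, CellProbe.output,
              Finset.piecewise_eq_of_notMem _ _ _ hH] at this
            exact ⟨by omega, this.2⟩
          rcases CellProbe.zmod_two_cases (c addr) with h | h <;> rw [h] at hmem <;> simp [hmem]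
        have hcard := (Finset.card_le_card hsub).trans (Finset.card_union_le _ _)
        have := Nat.mul_le_mul_right J.card hcard
        have h0 := ih 0 t u J
        have h1 := ih 1 t u J
        linarith
  | write addr b next ih =>
    rcases J.eq_empty_or_nonempty with rfl | ⟨x₀, hx₀⟩
    · simp
    cases t with
    | zero =>
      have : answerable (CellProbe.write addr b next) 0 H u J = ∅ := by
        refine Finset.eq_empty_of_forall_notMem fun a ha => ?_
        obtain ⟨c, hc⟩ := mem_answerable.mp ha
        have := (hc x₀ hx₀).1
        simp [CellProbe.time] at this
      simp [this]
    | succ t =>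
      have hsub : answerable (CellProbe.write addr b next) (t + 1) H u J
          ⊆ answerable next t H (fun x => Function.update (u x) addr b) J := by
        intro a ha
        obtain ⟨c, hc⟩ := mem_answerable.mp ha
        -- Writing to both memories covers `addr ∈ H` and `addr ∉ H` at once.
        refine mem_answerable.mpr ⟨Function.update c addr b, fun x hx => ?_⟩
        have := hc x hx
        simp only [CellProbe.time, CellProbe.output, Finset.update_piecewise] at this
        exact ⟨by omega, this.2⟩
      have h0 := ih t (fun x => Function.update (u x) addr b) J
      have := Nat.mul_le_mul_right J.card (Finset.card_le_card hsub)
      rw [pow_succ]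
      have : 0 < 2 ^ n * 2 ^ t := by positivity
      linarith

/-! ### Hot cells and unaffected queries -/

namespace MultiphaseDS

variable {n m : ℕ}

theorem exists_changed_runUpdates (D : MultiphaseDS n m) (M : Matrix (Fin m) (Fin n) (ZMod 2))
    (X : Fin n → ZMod 2) :
    ∃ S : Finset ℕ, S.card ≤ (D.runUpdates M X).2 ∧
      ∀ a ∉ S, (D.runUpdates M X).1 a = D.memoryAfterPreprocess M a := by
  unfold runUpdates
  have key : ∀ (l : List (Fin n)) (s : Memory × ℕ) (S : Finset ℕ), S.card ≤ s.2 →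
      (∀ a ∉ S, s.1 a = D.memoryAfterPreprocess M a) →
      ∃ S' : Finset ℕ, S'.card ≤ (l.foldl (fun s j => ((D.update j (X j)).finalMemory s.1,
          s.2 + (D.update j (X j)).time s.1)) s).2 ∧
        ∀ a ∉ S', (l.foldl (fun s j => ((D.update j (X j)).finalMemory s.1,
          s.2 + (D.update j (X j)).time s.1)) s).1 a = D.memoryAfterPreprocess M a := by
    intro l
    induction l with
    | nil => intro s S h1 h2; exact ⟨S, h1, h2⟩
    | cons j l ih =>
      intro s S h1 h2
      obtain ⟨S₁, h3, h4⟩ := (D.update j (X j)).exists_changed s.1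
      rw [List.foldl_cons]
      refine ih _ (S ∪ S₁) ((Finset.card_union_le _ _).trans (Nat.add_le_add h1 h3)) ?_
      intro a ha
      simp only [Finset.mem_union, not_or] at ha
      exact (h4 a ha.2).trans (h2 a ha.1)
  exact key _ _ ∅ (by simp) (by simp)

/-- The queries that may read the cell `a` within `t` steps. -/
def readers (D : MultiphaseDS n m) (t a : ℕ) : Finset (Fin m) :=
  Finset.univ.filter fun i => a ∈ (D.query i).readAddrs t

/-- The cells that more than `K` queries may read within `t` steps. -/
def hotCells (D : MultiphaseDS n m) (t K : ℕ) : Finset ℕ :=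
  (Finset.univ.biUnion fun i => (D.query i).readAddrs t).filter fun a => K < (D.readers t a).card

/-- Double counting of the pairs of a hot cell and a query that may read it. -/
theorem card_hotCells_mul_le (D : MultiphaseDS n m) (t K : ℕ) :
    (D.hotCells t K).card * K ≤ m * 2 ^ t := by
  calc (D.hotCells t K).card * K = ∑ a ∈ D.hotCells t K, K := by simp
    _ ≤ ∑ a ∈ D.hotCells t K, (D.readers t a).card :=
        Finset.sum_le_sum fun a ha => (Finset.mem_filter.mp ha).2.le
    _ = ∑ i : Fin m, ((D.hotCells t K).filter fun a => a ∈ (D.query i).readAddrs t).card := by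
        simp only [readers, Finset.card_filter]
        exact Finset.sum_comm
    _ ≤ ∑ _i : Fin m, 2 ^ t := by
        refine Finset.sum_le_sum fun i _ => (Finset.card_le_card ?_).trans
          ((D.query i).card_readAddrs_lt t).le
        intro a ha
        exact (Finset.mem_filter.mp ha).2
    _ = m * 2 ^ t := by simp

theorem card_readers_le_of_notMem_hotCells (D : MultiphaseDS n m) {t K a : ℕ}
    (ha : a ∉ D.hotCells t K) : (D.readers t a).card ≤ K := by
  by_contra! h
  refine ha (Finset.mem_filter.mpr ⟨?_, h⟩)
  obtain ⟨i, hi⟩ := Finset.card_pos.mp (by omega : 0 < (D.readers t a).card)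
  exact Finset.mem_biUnion.mpr ⟨i, Finset.mem_univ _, (Finset.mem_filter.mp hi).2⟩

/-- For all but few queries, the updates by the vectors in `J` change no cell that the query may
read, apart from hot ones. -/
theorem exists_unaffected_queries (D : MultiphaseDS n m) (t K T : ℕ)
    (M : Matrix (Fin m) (Fin n) (ZMod 2)) (J : Finset (Fin n → ZMod 2))
    (hT : ∀ X, (D.runUpdates M X).2 ≤ T) :
    ∃ G : Finset (Fin m), m ≤ G.card + J.card * (T * K) ∧
      ∀ i ∈ G, ∀ X ∈ J, ∀ a ∈ (D.query i).readAddrs t,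
        (D.runUpdates M X).1 a = (D.hotCells t K).piecewise (D.runUpdates M X).1
          (D.memoryAfterPreprocess M) a := by
  choose S hS hS' using D.exists_changed_runUpdates M
  let bad : Finset (Fin m) :=
    J.biUnion fun X => (S X \ D.hotCells t K).biUnion fun a => D.readers t a
  have hbad : bad.card ≤ J.card * (T * K) := by
    refine Finset.card_biUnion_le_card_mul _ _ _ fun X _ => ?_
    refine (Finset.card_biUnion_le_card_mul _ _ K fun a ha => ?_).trans ?_
    · exact D.card_readers_le_of_notMem_hotCells (Finset.mem_sdiff.mp ha).2
    · exact Nat.mul_le_mul_right _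
        ((Finset.card_le_card Finset.sdiff_subset).trans ((hS X).trans (hT X)))
  refine ⟨badᶜ, ?_, ?_⟩
  · have := Finset.card_compl_add_card bad
    rw [Fintype.card_fin] at this
    omega
  · intro i hi X hX a ha
    by_cases haH : a ∈ D.hotCells t K
    · rw [Finset.piecewise_eq_of_mem _ _ _ haH]
    · rw [Finset.piecewise_eq_of_notMem _ _ _ haH]
      refine hS' X a fun haS => Finset.mem_compl.mp hi ?_
      exact Finset.mem_biUnion.mpr ⟨X, hX, Finset.mem_biUnion.mpr
        ⟨a, Finset.mem_sdiff.mpr ⟨haS, haH⟩, Finset.mem_filter.mpr ⟨Finset.mem_univ _, ha⟩⟩⟩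

/-! ### Counting matrices -/

/-- Extension by zero of given contents of the cells in `H`, for each vector in `J`. -/
noncomputable def extendCells (H : Finset ℕ) (J : Finset (Fin n → ZMod 2))
    (u : J → H → ZMod 2) (x : Fin n → ZMod 2) : Memory :=
  fun a => if h : x ∈ J ∧ a ∈ H then u ⟨x, h.1⟩ ⟨a, h.2⟩ else 0

/-- The counting bound: few steps per query and few changed cells are contradictory. -/
theorem lt_mul_of_solves_within (D : MultiphaseDS n m) (t T : ℕ) (hm : 0 < m) (hn : t + 4 ≤ n)
    (hT : ∀ M X, (D.runUpdates M X).2 ≤ T)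
    (hq : ∀ M X i, (D.query i).time (D.runUpdates M X).1 ≤ t)
    (hc : ∀ M X i, (D.query i).output (D.runUpdates M X).1 = ∑ j, M i j * X j) :
    m < 2 ^ (3 * t + 10) * T := by
  classical
  by_contra! hmT
  obtain ⟨J, -, hJ⟩ := Finset.exists_subset_card_eq
    (s := (Finset.univ : Finset (Fin n → ZMod 2))) (n := 2 ^ (t + 4))
    (by simpa [ZMod.card] using Nat.pow_le_pow_right (by norm_num : 0 < 2) hn)
  -- This `K` balances two demands: |J|·|H| ≤ m/2 for the advice, and |J|·T·K = 2^(3t+9) T ≤ m/2 for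
  -- the affected queries.
  set K := 2 ^ (2 * t + 5) with hK
  set H := D.hotCells t K with hHdef
  have hH : J.card * H.card < m := by
    have h1 := D.card_hotCells_mul_le t K
    rw [← hHdef, hK] at h1
    rw [hJ]
    have h2 : 2 * (2 ^ (t + 4) * H.card) * 2 ^ t ≤ m * 2 ^ t := by
      calc 2 * (2 ^ (t + 4) * H.card) * 2 ^ t = H.card * 2 ^ (2 * t + 5) := by ring
        _ ≤ _ := h1
    have h3 := Nat.le_of_mul_le_mul_right h2 (by positivity)
    omega
  let B (u : J → H → ZMod 2) (i : Fin m) : Finset (Fin n → ZMod 2) :=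
    answerable (D.query i) t H (extendCells H J u) J
  let 𝒢 : Finset (Finset (Fin m)) := Finset.univ.filter fun G => m ≤ 2 * G.card
  let F (u : J → H → ZMod 2) (G : Finset (Fin m)) : Finset (Fin m → Fin n → ZMod 2) :=
    Fintype.piFinset fun i => if i ∈ G then B u i else Finset.univ
  have hcover : (Finset.univ : Finset (Fin m → Fin n → ZMod 2))
      ⊆ Finset.univ.biUnion fun u => 𝒢.biUnion fun G => F u G := by
    intro M _
    obtain ⟨G, hG, hagree⟩ := D.exists_unaffected_queries t K T M J (hT M)
    simp only [Finset.mem_biUnion, Finset.mem_univ, true_and]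
    refine ⟨fun x a => (D.runUpdates M x).1 a, G, ?_, ?_⟩
    · refine Finset.mem_filter.mpr ⟨Finset.mem_univ _, ?_⟩
      have : 2 * (J.card * (T * K)) = 2 ^ (3 * t + 10) * T := by
        rw [hJ, hK]; ring
      omega
    · refine Fintype.mem_piFinset.mpr fun i => ?_
      split_ifs with hi
      · refine mem_answerable.mpr ⟨D.memoryAfterPreprocess M, fun x hx => ?_⟩
        have hpw : H.piecewise (extendCells H J (fun x a => (D.runUpdates M x).1 a) x)
            (D.memoryAfterPreprocess M)
            = H.piecewise (D.runUpdates M x).1 (D.memoryAfterPreprocess M) := by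
          refine Finset.piecewise_congr H (fun a ha => ?_) (fun _ _ => rfl)
          simp [extendCells, hx, ha]
        obtain ⟨h1, h2⟩ := (D.query i).output_time_congr t _ _ (hq M x i) (hagree i hi x hx)
        rw [hpw, ← h1, ← h2]
        exact ⟨hq M x i, hc M x i⟩
      · exact Finset.mem_univ _
  -- Each row in `G` gains a factor 16, and 16^|G| ≥ 4^m because |G| ≥ m/2.
  have hF : ∀ u, ∀ G ∈ 𝒢, 4 ^ m * (F u G).card ≤ (2 ^ n) ^ m := by
    intro u G hG
    have hGm : m ≤ 2 * G.card := (Finset.mem_filter.mp hG).2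
    have hB : ∀ i, 16 * (B u i).card ≤ 2 ^ n := by
      intro i
      have h1 := card_answerable_mul_card_le (D.query i) t H (extendCells H J u) J
      rw [hJ] at h1
      refine Nat.le_of_mul_le_mul_right (c := 2 ^ t) ?_ (by positivity)
      calc 16 * (B u i).card * 2 ^ t = (B u i).card * 2 ^ (t + 4) := by ring
        _ ≤ _ := h1
    calc 4 ^ m * (F u G).card ≤ 4 ^ (2 * G.card) * (F u G).card :=
          Nat.mul_le_mul_right _ (Nat.pow_le_pow_right (by norm_num) hGm)
      _ = ∏ i : Fin m, (if i ∈ G then 16 else 1)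
            * (if i ∈ G then B u i else Finset.univ).card := by
          rw [Finset.prod_mul_distrib, Fintype.card_piFinset, Finset.prod_ite_mem, pow_mul]
          simp
      _ ≤ ∏ _i : Fin m, 2 ^ n := by
          refine Finset.prod_le_prod' fun i _ => ?_
          split_ifs with hi
          · exact hB i
          · simp [ZMod.card]
      _ = (2 ^ n) ^ m := by simp
  -- Union bound over 2^(|J|·|H|) advice strings and at most 2^m sets `G`; the gain 4^m beats both
  -- since |J|·|H| < m.
  have hcount : 4 ^ m * (2 ^ n) ^ m ≤ 2 ^ (J.card * H.card) * (2 ^ m * (2 ^ n) ^ m) := by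
    calc 4 ^ m * (2 ^ n) ^ m
        = 4 ^ m * (Finset.univ : Finset (Fin m → Fin n → ZMod 2)).card := by simp [ZMod.card]
      _ ≤ 4 ^ m * ∑ u, ∑ G ∈ 𝒢, (F u G).card := by
          refine Nat.mul_le_mul_left _ ((Finset.card_le_card hcover).trans
            (Finset.card_biUnion_le.trans (Finset.sum_le_sum fun u _ => Finset.card_biUnion_le)))
      _ = ∑ u : J → H → ZMod 2, ∑ G ∈ 𝒢, 4 ^ m * (F u G).card := by
          simp only [Finset.mul_sum]
      _ ≤ ∑ _u : J → H → ZMod 2, 2 ^ m * (2 ^ n) ^ m := by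
          refine Finset.sum_le_sum fun u _ => (Finset.sum_le_sum (hF u)).trans ?_
          rw [Finset.sum_const, smul_eq_mul]
          refine Nat.mul_le_mul_right _ ((Finset.card_le_univ _).trans ?_)
          simp
      _ = 2 ^ (J.card * H.card) * (2 ^ m * (2 ^ n) ^ m) := by
          simp [ZMod.card, ← pow_mul, mul_comm]
  have h4 : (4 : ℕ) ^ m = 2 ^ m * 2 ^ m := by rw [← mul_pow]; norm_num
  rw [h4] at hcount
  have h5 : 2 ^ m ≤ 2 ^ (J.card * H.card) := by
    refine Nat.le_of_mul_le_mul_right (c := 2 ^ m * (2 ^ n) ^ m) ?_ (by positivity)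
    calc 2 ^ m * (2 ^ m * (2 ^ n) ^ m) = 2 ^ m * 2 ^ m * (2 ^ n) ^ m := by ring
      _ ≤ _ := hcount
  exact absurd ((Nat.pow_le_pow_iff_right (by norm_num)).mp h5) (by omega)

/-- Queries cannot be answered without any memory access. -/
theorem exists_query_time_pos (D : MultiphaseDS n m) (hn : 0 < n) (i : Fin m)
    (hc : ∀ M X i, (D.query i).output (D.runUpdates M X).1 = ∑ j, M i j * X j) :
    ∃ M X, 0 < (D.query i).time (D.runUpdates M X).1 := by
  cases hqi : D.query i with
  | done b =>
    have h0 := hc 0 0 i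
    -- A constant answer cannot be both 0 (zero matrix) and 1 (all-ones matrix, unit vector).
    have h1 := hc (fun _ _ => 1) (Pi.single ⟨0, hn⟩ 1) i
    rw [hqi] at h0 h1
    simp [CellProbe.output] at h0 h1
    exact absurd (h0.symm.trans h1) (by decide)
  | read addr next => exact ⟨0, 0, by simp [CellProbe.time]⟩
  | write addr b next => exact ⟨0, 0, by simp [CellProbe.time]⟩

end MultiphaseDS

/-! ### Choice of constants -/

theorem corollary1p2 (C δ : ℝ) (hC : 0 < C) (hδ : 0 < δ) :
    ∃ c : ℝ, 0 < c ∧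
      ∀ n m : ℕ, (2 : ℝ) ^ (δ * √(n : ℝ)) ≤ (m : ℝ) →
        ∀ (tu tq : ℝ) (D : MultiphaseDS n m), D.Solves tu tq →
          (n : ℝ) * tu ≤ C * (m : ℝ) ^ (0.99 : ℝ) →
            c * (n : ℝ) ^ (1 / 2 : ℝ) ≤ tq := by
  obtain ⟨L, hL⟩ : ∃ L : ℕ, C ≤ 2 ^ L := pow_unbounded_of_one_lt C (by norm_num) |>.imp
    fun _ h => h.le
  -- below `R = √n` the trivial bound `1 ≤ tq` suffices
  obtain ⟨R, hR4, hRL⟩ : ∃ R : ℝ, 4 ≤ R ∧ (10 + L : ℝ) ≤ 0.007 * δ * R := by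
    refine ⟨max 4 ((10 + L) / (0.007 * δ)), le_max_left _ _, ?_⟩
    have := le_max_right 4 ((10 + L : ℝ) / (0.007 * δ))
    rwa [div_le_iff₀ (by positivity), mul_comm] at this
  have hR0 : 0 < R := by linarith
  refine ⟨min (δ / 1000) (1 / R), by positivity, ?_⟩
  set c := min (δ / 1000) (1 / R) with hcdef
  have hcδ : c ≤ δ / 1000 := min_le_left _ _
  have hcR : c ≤ 1 / R := min_le_right _ _
  intro n m hnm tu tq D hD htu
  rw [← Real.sqrt_eq_rpow]
  by_contra! hlt
  have hm1 : (1 : ℝ) ≤ m :=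
    (Real.one_le_rpow (by norm_num) (by positivity)).trans hnm
  have hm : 0 < m := by exact_mod_cast lt_of_lt_of_le one_pos hm1
  have htq0 : 0 ≤ tq := (Nat.cast_nonneg _).trans (hD.query_time 0 0 ⟨0, hm⟩)
  have hn : 0 < n := by
    rcases Nat.eq_zero_or_pos n with rfl | h
    · simp at hlt; linarith
    · exact h
  obtain ⟨M, X, hpos⟩ := D.exists_query_time_pos hn ⟨0, hm⟩ hD.query_correct
  have htq1 : 1 ≤ tq := le_trans (by exact_mod_cast hpos) (hD.query_time M X ⟨0, hm⟩)
  have hRn : R < √(n : ℝ) := by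
    by_contra! h
    have : c * √(n : ℝ) ≤ 1 / R * R := by gcongr
    rw [one_div_mul_cancel hR0.ne'] at this
    linarith
  set t := ⌊tq⌋₊ with ht
  set T := ⌊C * (m : ℝ) ^ (0.99 : ℝ)⌋₊ with hTdef
  have htle : (t : ℝ) ≤ tq := Nat.floor_le htq0
  have htn : t + 4 ≤ n := by
    have h1 : c * √(n : ℝ) ≤ 1 / 4 * √(n : ℝ) := by
      gcongr
      exact hcR.trans (one_div_le_one_div_of_le (by norm_num) hR4)
    have h2 : √(n : ℝ) * √(n : ℝ) = n := Real.mul_self_sqrt (Nat.cast_nonneg _)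
    have : (t : ℝ) + 4 ≤ n := by nlinarith
    exact_mod_cast this
  have hmain := D.lt_mul_of_solves_within t T hm htn
    (fun M X => Nat.le_floor ((hD.update_time M X).trans htu))
    (fun M X i => Nat.le_floor (hD.query_time M X i)) hD.query_correct
  have hTle : (T : ℝ) ≤ C * (m : ℝ) ^ (0.99 : ℝ) := Nat.floor_le (by positivity)
  -- The exponent budget 0.01·δ√n splits as 0.003 for 3t, by c ≤ δ/1000, and 0.007 for 10 + L, by √n
  -- > R.
  have hpow : (2 : ℝ) ^ (3 * t + 10) * C ≤ (m : ℝ) ^ (0.01 : ℝ) := by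
    calc (2 : ℝ) ^ (3 * t + 10) * C ≤ 2 ^ (3 * t + 10) * 2 ^ L := by gcongr
      _ = (2 : ℝ) ^ (((3 * t + 10 + L : ℕ)) : ℝ) := by rw [Real.rpow_natCast, ← pow_add]
      _ ≤ (2 : ℝ) ^ (δ * √(n : ℝ) * 0.01) := by
          refine Real.rpow_le_rpow_of_exponent_le (by norm_num) ?_
          push_cast
          have h1 : c * √(n : ℝ) ≤ δ / 1000 * √(n : ℝ) := by gcongr
          have h2 : 0.007 * δ * R ≤ 0.007 * δ * √(n : ℝ) := by gcongr
          linarith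
      _ = ((2 : ℝ) ^ (δ * √(n : ℝ))) ^ (0.01 : ℝ) := Real.rpow_mul (by norm_num) _ _
      _ ≤ (m : ℝ) ^ (0.01 : ℝ) := by gcongr
  have : (m : ℝ) < m := by
    calc (m : ℝ) < 2 ^ (3 * t + 10) * T := by exact_mod_cast hmain
      _ ≤ 2 ^ (3 * t + 10) * (C * (m : ℝ) ^ (0.99 : ℝ)) := by gcongr
      _ = 2 ^ (3 * t + 10) * C * (m : ℝ) ^ (0.99 : ℝ) := by ring
      _ ≤ (m : ℝ) ^ (0.01 : ℝ) * (m : ℝ) ^ (0.99 : ℝ) := by gcongr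
      _ = m := by
          rw [← Real.rpow_add (by linarith)]
          norm_num
  exact lt_irrefl _ this
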